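/- Let $d$ be a natural number, let $G=(V,E)$ be a finite simple graph and let $u,v\in V$. A realization of a graph $H$ in $\mathbb{R}^d$ is a map $p:V(H)\to\mathbb{R}^d$; it is generic if its $d|V(H)|$ coordinates are algebraically independent over $\mathbb{Q}$. Realizations $p,q$ of $H$ are equivalent if $\|p(x)-p(y)\|=\|q(x)-q(y)\|$ (Euclidean norm) for every edge $xy$ of $H$, and congruent if this holds for all $x,y\in V(H)$. A realization $p$ of $H$ is rigid if there is $\varepsilon>0$ such that every realization $q$ of $H$ that is equivalent to $p$ and satisfies $\|p(x)-q(x)\|<\varepsilon$ for all $x\in V(H)$ is congruent to $p$; the graph $H$ is rigid in $\mathbb{R}^d$ if every generic realization of $H$ in $\mathbb{R}^d$ is rigid. Suppose that there is some $V_0\subseteq V$ such that $u,v\in V_0$, the induced subgraph $G[V_0]$ is rigid in $\mathbb{R}^d$, and there is a path in $G$ from $u$ to $v$ none of whose internal vertices belongs to $V_0$. Then $\{u,v\}$ is weakly globally linked in $G$ in $\mathbb{R}^d$: there exists a generic realization $p$ of $G$ in $\mathbb{R}^d$ such that $\|p(u)-p(v)\|=\|q(u)-q(v)\|$ for every realization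 $q$ of $G$ in $\mathbb{R}^d$ that is equivalent to $p$. -/

import Mathlib

namespace GraphRigidity

/-- A realization of a graph with vertex set `V` in `ℝ^d` (with the Euclidean norm). -/
abbrev Realization (V : Type*) (d : ℕ) := V → EuclideanSpace ℝ (Fin d)

/-- The frameworks `(G, p)` and `(G, q)` have the same edge lengths. -/
def Equivalent {V : Type*} {d : ℕ} (G : SimpleGraph V) (p q : Realization V d) : Prop :=
  ∀ x y : V, G.Adj x y → ‖p x - p y‖ = ‖q x - q y‖

/-- All pairwise distances agree in `p` and `q`. -/
def Congruent {V : Type*} {d : ℕ} (p q : Realization V d) : Prop :=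
  ∀ x y : V, ‖p x - p y‖ = ‖q x - q y‖

/-- The (indexed family of) `d|V|` vertex coordinates is algebraically independent over `ℚ`. -/
def IsGeneric {V : Type*} {d : ℕ} (p : Realization V d) : Prop :=
  AlgebraicIndependent ℚ (fun c : V × Fin d => p c.1 c.2)

/-- The framework `(G, p)` is rigid in `ℝ^d`. -/
def IsRigidFramework {V : Type*} {d : ℕ} (G : SimpleGraph V) (p : Realization V d) : Prop :=
  ∃ ε : ℝ, 0 < ε ∧ ∀ q : Realization V d,
    Equivalent G p q → (∀ x : V, ‖p x - q x‖ < ε) → Congruent p q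

/-- The graph `G` is rigid in `ℝ^d`: every generic realization of it is rigid. -/
def IsRigid {V : Type*} (d : ℕ) (G : SimpleGraph V) : Prop :=
  ∀ p : Realization V d, IsGeneric p → IsRigidFramework G p

/-- The induced subgraph `G[X]` is `(u,v)`-rigid in `ℝ^d`. -/
def IsPairRigid {V : Type*} (d : ℕ) (G : SimpleGraph V) (u v : V) (X : Set V) : Prop :=
  u ∈ X ∧ v ∈ X ∧ IsRigid d (G.induce X)

/-- The pair `{u,v}` is globally linked in the framework `(G, p)`. -/
def GloballyLinkedIn {V : Type*} {d : ℕ} (G : SimpleGraph V) (p : Realization V d)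
    (u v : V) : Prop :=
  ∀ q : Realization V d, Equivalent G p q → ‖p u - p v‖ = ‖q u - q v‖

/-- The pair `{u,v}` is weakly globally linked in `G` in `ℝ^d`. -/
def WeaklyGloballyLinked {V : Type*} (d : ℕ) (G : SimpleGraph V) (u v : V) : Prop :=
  ∃ p : Realization V d, IsGeneric p ∧ GloballyLinkedIn G p u v

/-- The walk `P` from `u` to `v` is a path, none of whose internal vertices lies in `X`. -/
def IsInternallyDisjointPath {V : Type*} {G : SimpleGraph V} {u v : V} (P : G.Walk u v)
    (X : Set V) : Prop :=
  P.IsPath ∧ ∀ w ∈ P.support, w ≠ u → w ≠ v → w ∉ X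

end GraphRigidity

/-! Let `p` be a generic realization of `G[V₀]`. Rigidity makes the squared distance of `u` and `v`
algebraic over the squared edge lengths: otherwise it could vary with the edge lengths fixed,
because polynomial maps are open where their values are algebraically independent
(`IsRigidFramework.isAlgebraic_sqDist`).

The resulting relation leaves finitely many values for this distance over the realizations
equivalent to `p`; let `q₀` attain the least. It is a simple root, and by semicontinuity nothing
notably smaller appears near `q₀`. So a framework near `q₀` determines the distance among equivalent
ones where it is not much larger (`IsRigid.exists_eventually_norm_eq`).

With all vertices outside `V₀` placed at `q₀ u`, the path is exactly as long as the distance from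
`u` to `v`. After a small generic perturbation, the triangle inequality along the path excludes the
larger values. -/

/-! ### Derivations and openness of polynomial maps -/

open scoped TensorProduct IntermediateField.algebraAdjoinAdjoin in
/-- In characteristic zero, a transcendence basis admits a dual family of derivations. -/
theorem IsTranscendenceBasis.exists_derivation {K L ι : Type*} [Field K] [Field L] [CharZero K]
    [Algebra K L] [DecidableEq ι] {x : ι → L} (hx : IsTranscendenceBasis K x) (i : ι) :
    ∃ D : Derivation K L L, ∀ j, D (x j) = if j = i then 1 else 0 := by
  let S := Algebra.adjoin K (Set.range x)
  let F := IntermediateField.adjoin K (Set.range x)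
  let e : MvPolynomial ι K ≃ₐ[K] S := hx.1.aevalEquiv
  let D₀ : Derivation K S S := Derivation.mk'
    (e.toLinearMap ∘ₗ (MvPolynomial.pderiv i).toLinearMap ∘ₗ e.symm.toLinearMap) (by
      intro a b
      simp [Derivation.leibniz])
  have hD₀ : ∀ j, D₀ (e (MvPolynomial.X j)) = if j = i then 1 else 0 := by
    intro j
    change e (MvPolynomial.pderiv i (e.symm (e (MvPolynomial.X j)))) = _
    rw [AlgEquiv.symm_apply_apply, MvPolynomial.pderiv_X, Pi.single_apply]
    split_ifs <;> simp
  have : CharZero F := charZero_of_injective_algebraMap (algebraMap K F).injective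
  -- `F` is a localization of `S` and `L` is separable algebraic over `F`, so derivations extend
  -- from `S` to `L`.
  have : Algebra.FormallyEtale S L := by
    have : Algebra.FormallyEtale S F := .of_isLocalization (nonZeroDivisors _)
    have : Algebra.IsAlgebraic F L := hx.isAlgebraic_field
    have : Algebra.FormallyEtale F L := .of_isSeparable F L
    exact .comp S F L
  let φ : L ⊗[S] Ω[S⁄K] →ₗ[L] L :=
    LinearMap.liftBaseChange L (Algebra.linearMap S L ∘ₗ D₀.liftKaehlerDifferential)
  let ψ := KaehlerDifferential.tensorKaehlerEquivOfFormallyEtale K S L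
  refine ⟨(φ ∘ₗ ψ.symm.toLinearMap).compDer (KaehlerDifferential.D K L), fun j => ?_⟩
  have hxj : x j = algebraMap S L (e (MvPolynomial.X j)) := by
    simp [e, S]
  rw [hxj]
  change φ (ψ.symm (KaehlerDifferential.D K L _)) = _
  rw [KaehlerDifferential.tensorKaehlerEquivOfFormallyEtale_symm_D_algebraMap]
  simp only [φ, LinearMap.liftBaseChange_tmul, LinearMap.comp_apply,
    Derivation.liftKaehlerDifferential_comp_D, hD₀]
  split_ifs <;> simp

theorem AlgebraicIndependent.exists_derivation {K L ι : Type*} [Field K] [Field L] [CharZero K]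
    [Algebra K L] [DecidableEq ι] {x : ι → L} (hx : AlgebraicIndependent K x) (i : ι) :
    ∃ D : Derivation K L L, ∀ j, D (x j) = if j = i then 1 else 0 := by
  classical
  obtain ⟨B, hxB, hB⟩ := exists_isTranscendenceBasis_superset hx.to_subtype_range
  obtain ⟨D, hD⟩ := hB.exists_derivation ⟨x i, hxB ⟨i, rfl⟩⟩
  refine ⟨D, fun j => ?_⟩
  have := hD ⟨x j, hxB ⟨j, rfl⟩⟩
  simpa [hx.injective.eq_iff] using this

theorem Derivation.map_mvPolynomial_aeval {K L σ : Type*} [CommRing K] [CommRing L] [Algebra K L]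
    [Fintype σ] (D : Derivation K L L) (p : σ → L) (g : MvPolynomial σ K) :
    D (MvPolynomial.aeval p g) =
      ∑ k, MvPolynomial.aeval p (MvPolynomial.pderiv k g) * D (p k) := by
  classical
  induction g using MvPolynomial.induction_on with
  | C a => simp
  | add f g hf hg => simp [hf, hg, add_mul, Finset.sum_add_distrib]
  | mul_X f i hf =>
    simp [hf, Derivation.leibniz, MvPolynomial.pderiv_X, Pi.single_apply, add_mul,
      Finset.sum_add_distrib, Finset.mul_sum, apply_ite (MvPolynomial.aeval p), ite_mul]
    refine Finset.sum_congr rfl fun k _ => by ring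

theorem MvPolynomial.hasStrictFDerivAt_aeval {K σ : Type*} [CommRing K] [Algebra K ℝ]
    [Fintype σ] (p : σ → ℝ) (g : MvPolynomial σ K) :
    HasStrictFDerivAt (fun x : σ → ℝ => MvPolynomial.aeval x g)
      (∑ k, MvPolynomial.aeval p (MvPolynomial.pderiv k g) •
        (ContinuousLinearMap.proj k : (σ → ℝ) →L[ℝ] ℝ)) p := by
  classical
  induction g using MvPolynomial.induction_on with
  | C a => simpa using hasStrictFDerivAt_const (algebraMap K ℝ a) p
  | add f g hf hg =>
    refine (hf.fun_add hg).congr_fderiv ?_ |>.congr_of_eventuallyEq (.of_forall fun x => ?_)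
    · simp [add_smul, Finset.sum_add_distrib]
    · simp
  | mul_X f i hf =>
    have hi : HasStrictFDerivAt (fun x : σ → ℝ => x i)
      (ContinuousLinearMap.proj i : (σ → ℝ) →L[ℝ] ℝ) p :=
      (ContinuousLinearMap.proj i : (σ → ℝ) →L[ℝ] ℝ).hasStrictFDerivAt
    have := hf.mul hi
    simp only [map_mul, aeval_X]
    refine this.congr_fderiv ?_
    ext v
    simp [Derivation.leibniz, MvPolynomial.pderiv_X, Pi.single_apply, add_mul,
      Finset.sum_add_distrib, Finset.mul_sum, apply_ite (MvPolynomial.aeval p), ite_mul]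
    refine Finset.sum_congr rfl fun k _ => by ring

/-- A polynomial map is open at a point where its values are algebraically independent. -/
theorem AlgebraicIndependent.map_nhds_aeval_eq {σ J : Type*} [Finite σ] [Finite J]
    {p : σ → ℝ} {g : J → MvPolynomial σ ℚ}
    (h : AlgebraicIndependent ℚ fun j => MvPolynomial.aeval p (g j)) :
    Filter.map (fun (x : σ → ℝ) (j : J) => MvPolynomial.aeval x (g j)) (nhds p) =
      nhds fun j => MvPolynomial.aeval p (g j) := by
  classical
  have := Fintype.ofFinite σ
  have := Fintype.ofFinite J
  have hd := hasStrictFDerivAt_pi.2 fun j => MvPolynomial.hasStrictFDerivAt_aeval p (g j)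
  refine hd.map_nhds_eq_of_surj (LinearMap.range_eq_top.2 fun y => ?_)
  -- By the chain rule, the vectors `D j (p k)` are dual to the differentials of the `g i` at `p`.
  choose D hD using fun j => h.exists_derivation j
  refine ⟨∑ j, y j • fun k => D j (p k), ?_⟩
  ext i
  have key : ∀ j, ∑ k, MvPolynomial.aeval p (MvPolynomial.pderiv k (g i)) * D j (p k) =
      if i = j then 1 else 0 := fun j => by
    rw [← (D j).map_mvPolynomial_aeval, hD]
  simp [key]

theorem MvPolynomial.continuous_aeval {σ K A : Type*} [CommSemiring K] [CommSemiring A]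
    [Algebra K A] [TopologicalSpace A] [IsTopologicalSemiring A] (g : MvPolynomial σ K) :
    Continuous fun x : σ → A => MvPolynomial.aeval x g := by
  simp_rw [MvPolynomial.aeval_def, MvPolynomial.eval₂_eq_eval_map]
  exact MvPolynomial.continuous_eval _

/-! ### Algebraic relations between polynomial values at a generic point -/

open Polynomial in
open scoped IntermediateField.algebraAdjoinAdjoin in
/-- An algebraic dependence between values of polynomials at a generic point is realized by a
polynomial identity, which can be chosen separable at the generic point. -/
theorem AlgebraicIndependent.exists_separable_relation {σ E : Type*} {p : σ → ℝ}
    (hp : AlgebraicIndependent ℚ p) (f : E → MvPolynomial σ ℚ) (t : MvPolynomial σ ℚ)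
    (ht : IsAlgebraic (Algebra.adjoin ℚ (Set.range fun e => MvPolynomial.aeval p (f e)))
      (MvPolynomial.aeval p t)) :
    ∃ P : (MvPolynomial E ℚ)[X],
      (∀ q : σ → ℝ, (P.map (MvPolynomial.aeval
        fun e => MvPolynomial.aeval q (f e)).toRingHom).eval (MvPolynomial.aeval q t) = 0) ∧
      (P.map (MvPolynomial.aeval
        fun e => MvPolynomial.aeval p (f e)).toRingHom).Separable := by
  set y : E → ℝ := fun e => MvPolynomial.aeval p (f e) with hy
  let A := Algebra.adjoin ℚ (Set.range y)
  let K := IntermediateField.adjoin ℚ (Set.range y)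
  set s := MvPolynomial.aeval p t with hs
  have htK : IsAlgebraic K s := ht.extendScalars (R := A) (S := K)
    (FaithfulSMul.algebraMap_injective A K)
  let φ : MvPolynomial E ℚ →ₐ[ℚ] A :=
    MvPolynomial.aeval fun e => ⟨y e, Algebra.subset_adjoin ⟨e, rfl⟩⟩
  have hφv : A.val.comp φ = MvPolynomial.aeval y := by
    ext e; simp [φ]
  have hφ : Function.Surjective φ := by
    rintro ⟨a, ha⟩
    have ha' := ha
    simp only [A] at ha'
    rw [Algebra.adjoin_range_eq_range_aeval] at ha'
    obtain ⟨g, hg⟩ := ha'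
    exact ⟨g, Subtype.ext ((DFunLike.congr_fun hφv g).trans hg)⟩
  have hm : (minpoly K s).Separable := (minpoly.irreducible htK.isIntegral).separable
  -- Clearing denominators scales the minimal polynomial by a nonzero constant, which preserves
  -- separability.
  obtain ⟨b, hb, hbm⟩ := IsLocalization.integerNormalization_spec (nonZeroDivisors A) (minpoly K s)
  obtain ⟨P, hP⟩ := Polynomial.map_surjective φ.toRingHom hφ
    (IsLocalization.integerNormalization (nonZeroDivisors A) (minpoly K s))
  have hPy : P.map (MvPolynomial.aeval y).toRingHom =
      C (b : ℝ) * (minpoly K s).map (algebraMap K ℝ) := by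
    have h1 : (MvPolynomial.aeval y : MvPolynomial E ℚ →ₐ[ℚ] ℝ).toRingHom =
        ((algebraMap K ℝ).comp (algebraMap A K)).comp φ.toRingHom := by
      rw [← hφv]; rfl
    rw [h1, ← Polynomial.map_map, hP, ← Polynomial.map_map, hbm, Algebra.smul_def,
      Polynomial.map_mul]
    congr 1
    simp [Polynomial.algebraMap_apply]
    rfl
  have hb0 : (b : ℝ) ≠ 0 := by
    simpa using nonZeroDivisors.ne_zero hb
  refine ⟨P, fun q => ?_, ?_⟩
  -- The relation becomes a polynomial in the coordinates that vanishes at a generic point, hence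
  -- identically.
  · let G : MvPolynomial σ ℚ := P.eval₂ (MvPolynomial.aeval f).toRingHom t
    have hG : ∀ q : σ → ℝ, MvPolynomial.aeval q G = (P.map (MvPolynomial.aeval
        fun e => MvPolynomial.aeval q (f e)).toRingHom).eval (MvPolynomial.aeval q t) := by
      intro q
      rw [Polynomial.eval_map]
      refine (Polynomial.hom_eval₂ P _ (MvPolynomial.aeval q).toRingHom t).trans ?_
      congr 1
      ext e
      · simp
      · simp
    have hG0 : G = 0 := by
      apply hp
      rw [hG, map_zero, ← hy, hPy, eval_mul, eval_map_algebraMap, minpoly.aeval, mul_zero]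
    rw [← hG, hG0, map_zero]
  · rw [hPy]
    exact Separable.unit_mul (isUnit_C.2 hb0.isUnit) hm.map

/-- If the value of `t` at a generic point is not algebraic over the values of the polynomials `f`,
then `t` varies on every neighbourhood of that point within the fibre of `f`. -/
theorem AlgebraicIndependent.exists_ne_of_not_isAlgebraic {σ E : Type*} [Finite σ] [Finite E]
    {p : σ → ℝ} (hp : AlgebraicIndependent ℚ p) (f : E → MvPolynomial σ ℚ) (t : MvPolynomial σ ℚ)
    (ht : ¬ IsAlgebraic (Algebra.adjoin ℚ (Set.range fun e => MvPolynomial.aeval p (f e)))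
      (MvPolynomial.aeval p t)) {U : Set (σ → ℝ)} (hU : U ∈ nhds p) :
    ∃ q ∈ U, (∀ e, MvPolynomial.aeval q (f e) = MvPolynomial.aeval p (f e)) ∧
      MvPolynomial.aeval q t ≠ MvPolynomial.aeval p t := by
  classical
  set y : E → ℝ := fun e => MvPolynomial.aeval p (f e) with hy
  -- Openness needs independent values, so only a transcendence basis of the values of `f` is kept,
  -- together with `t`.
  obtain ⟨B, hB⟩ := (AlgebraicIndependent.matroid ℚ ℝ).exists_isBasis (Set.range y)
  have hiff := fun a => AlgebraicIndependent.isAlgebraic_adjoin_iff_of_matroid_isBasis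
    (a := a) hB
  have hBi : AlgebraicIndependent ℚ ((↑) : B → ℝ) :=
    AlgebraicIndependent.matroid_indep_iff.1 hB.indep
  have hBfin : Finite B := (Set.finite_range y).subset hB.subset
  choose i hi using fun b : B => hB.subset b.2
  let g : Option B → MvPolynomial σ ℚ := fun o => o.elim t fun b => f (i b)
  have hg : AlgebraicIndependent ℚ fun j => MvPolynomial.aeval p (g j) := by
    have := (hBi.option_iff_transcendental (MvPolynomial.aeval p t)).2 (by
      rw [Subtype.range_coe]
      exact fun h => ht ((hiff _).1 h))
    convert this using 1
    ext (_ | b)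
    · rfl
    · exact hi b
  -- Each remaining value is a root of a fixed nonzero polynomial while the basis values are fixed;
  -- by continuity it cannot jump to another root.
  have hrel : ∀ e, ∀ᶠ q in nhds p, (∀ b, MvPolynomial.aeval q (f (i b)) = y (i b)) →
      MvPolynomial.aeval q (f e) = y e := by
    intro e
    have halg : IsAlgebraic (Algebra.adjoin ℚ
        (Set.range fun b => MvPolynomial.aeval p (f (i b)))) (MvPolynomial.aeval p (f e)) := by
      have : (Set.range fun b => MvPolynomial.aeval p (f (i b))) = B := by
        simp only [y] at hi
        simp [hi]
      rw [this, hiff]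
      exact isAlgebraic_algebraMap
        (⟨y e, Algebra.subset_adjoin ⟨e, rfl⟩⟩ : Algebra.adjoin ℚ (Set.range y))
    obtain ⟨P, hP, hsep⟩ := hp.exists_separable_relation (fun b => f (i b)) (f e) halg
    set Q := P.map (MvPolynomial.aeval
        fun b => MvPolynomial.aeval p (f (i b))).toRingHom with hQ
    have hfin : ((Q.rootSet ℝ) \ {y e}).Finite := (Q.rootSet_finite ℝ).subset Set.sdiff_subset
    have hcont : Continuous fun q : σ → ℝ => MvPolynomial.aeval q (f e) :=
      MvPolynomial.continuous_aeval _
    filter_upwards [hcont.continuousAt.preimage_mem_nhds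
      (hfin.isClosed.isOpen_compl.mem_nhds (x := y e) (by simp))] with q hq hqB
    by_contra hne
    refine hq ⟨?_, hne⟩
    have h0 := hP q
    simp only [y] at hqB
    simp only [hqB, ← hQ] at h0
    rw [Polynomial.mem_rootSet]
    exact ⟨hsep.ne_zero, by simpa using h0⟩
  have hmap := hg.map_nhds_aeval_eq
  have himg := Filter.image_mem_map (m := fun (x : σ → ℝ) j => MvPolynomial.aeval x (g j))
    (Filter.inter_mem hU (Filter.eventually_all.2 hrel))
  rw [hmap] at himg
  have hupd : Continuous fun s : ℝ => Function.update
      (fun j => MvPolynomial.aeval p (g j)) none s := continuous_const.update none continuous_id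
  have hnear : ∀ᶠ s in nhdsWithin (MvPolynomial.aeval p t) {MvPolynomial.aeval p t}ᶜ,
      Function.update (fun j => MvPolynomial.aeval p (g j)) none s ∈ _ :=
    Filter.Eventually.filter_mono nhdsWithin_le_nhds
      (hupd.tendsto' (MvPolynomial.aeval p t) _ (Function.update_eq_self none _) himg)
  obtain ⟨s, ⟨q, ⟨hqU, hqE⟩, hqs⟩, hs⟩ := (hnear.and self_mem_nhdsWithin).exists
  refine ⟨q, hqU, fun e => hqE e fun b => ?_, ?_⟩
  · simpa [g] using congrFun hqs (some b)
  · have := congrFun hqs none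
    simp only [g, Option.elim_none, Function.update_self] at this
    rw [this]
    exact hs

/-! ### Generic realizations and rigidity -/

theorem Polynomial.transcendental_X_add_C {R : Type*} [CommRing R] (r : R) :
    Transcendental R (Polynomial.X + Polynomial.C r) := by
  rw [transcendental_iff]
  intro P hP
  rwa [← Polynomial.comp_eq_aeval, Polynomial.comp_X_add_C_eq_zero_iff] at hP

/-- A finite transcendence basis would make `ℝ` countable. -/
theorem Real.exists_algebraicIndependent_rat (σ : Type*) [Finite σ] :
    ∃ b : σ → ℝ, AlgebraicIndependent ℚ b := by
  obtain ⟨ι, x, hx⟩ := exists_isTranscendenceBasis' ℚ ℝ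
  have hinf : Infinite ι := by
    by_contra hfin
    rw [not_infinite_iff_finite] at hfin
    have hR : Cardinal.mk ℝ ≤ Cardinal.aleph0 := by
      rcases isEmpty_or_nonempty ι with h | h
      · have := hx.isEmpty_iff_isAlgebraic.1 h
        simpa using Algebra.IsAlgebraic.lift_cardinalMk_le_max ℚ ℝ
      · have := hx.lift_cardinalMk_eq_max_lift
        have hι := Cardinal.mk_le_aleph0 (α := ι)
        simp_all
    exact absurd hR (by rw [Cardinal.mk_real]; exact not_le.2 Cardinal.aleph0_lt_continuum)
  obtain ⟨n, ⟨e⟩⟩ := Finite.exists_equiv_fin σ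
  exact ⟨_, hx.1.comp (fun s => Infinite.natEmbedding ι (e s))
    fun a b h => e.injective (Fin.ext ((Infinite.natEmbedding ι).injective h))⟩

namespace GraphRigidity

variable {V : Type*} {d : ℕ}

theorem Equivalent.trans {G : SimpleGraph V} {p q r : Realization V d} (h : Equivalent G p q)
    (h' : Equivalent G q r) : Equivalent G p r := fun x y hxy => (h x y hxy).trans (h' x y hxy)

/-- The coordinates of a realization, as a function on `V × Fin d`. -/
def coords (p : Realization V d) : V × Fin d → ℝ := fun c => p c.1 c.2

/-- The realization with given coordinates. -/
def ofCoords (y : V × Fin d → ℝ) : Realization V d := fun x => WithLp.toLp 2 fun i => y (x, i)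

@[simp]
theorem coords_ofCoords (y : V × Fin d → ℝ) : coords (ofCoords y) = y := rfl

@[simp]
theorem ofCoords_coords (p : Realization V d) : ofCoords (coords p) = p := rfl

theorem continuous_coords : Continuous (coords : Realization V d → V × Fin d → ℝ) := by
  unfold coords
  fun_prop

theorem continuous_ofCoords : Continuous (ofCoords : (V × Fin d → ℝ) → Realization V d) := by
  unfold ofCoords
  fun_prop

/-- Generic realizations are dense. -/
theorem exists_isGeneric_of_mem_nhds [Finite V] {p₀ : Realization V d} {U : Set (Realization V d)}
    (hU : U ∈ nhds p₀) : ∃ p ∈ U, IsGeneric p := by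
  -- Rational translates of one independent tuple are dense and stay independent.
  obtain ⟨b, hb⟩ := Real.exists_algebraicIndependent_rat (V × Fin d)
  have hdense : DenseRange fun r : V × Fin d → ℚ => fun c => b c + (r c : ℝ) :=
    DenseRange.piMap fun c =>
      (Homeomorph.addLeft (b c)).surjective.denseRange.comp Rat.denseRange_cast
        (Homeomorph.addLeft (b c)).continuous
  have hU' : ofCoords ⁻¹' U ∈ nhds (coords p₀) :=
    continuous_ofCoords.continuousAt.preimage_mem_nhds (by simpa using hU)
  obtain ⟨r, hr⟩ := hdense.exists_mem_open isOpen_interior ⟨_, mem_interior_iff_mem_nhds.2 hU'⟩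
  refine ⟨ofCoords _, (interior_subset hr :), ?_⟩
  have := hb.polynomial_aeval_of_transcendental
    (f := fun c => Polynomial.X + Polynomial.C (r c))
    fun c => Polynomial.transcendental_X_add_C (r c)
  simpa [IsGeneric, ofCoords] using this

/-- The squared distance of two vertices, as a polynomial in the coordinates. -/
noncomputable def sqDistPoly (d : ℕ) (x y : V) : MvPolynomial (V × Fin d) ℚ :=
  ∑ i, (MvPolynomial.X (x, i) - MvPolynomial.X (y, i)) ^ 2

theorem aeval_sqDistPoly (p : Realization V d) (x y : V) :
    MvPolynomial.aeval (coords p) (sqDistPoly d x y) = ‖p x - p y‖ ^ 2 := by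
  simp [sqDistPoly, EuclideanSpace.real_norm_sq_eq, coords]

/-- The squared edge lengths, as polynomials in the coordinates. -/
noncomputable def sqEdgePoly (d : ℕ) (G : SimpleGraph V) (e : {e : V × V // G.Adj e.1 e.2}) :
    MvPolynomial (V × Fin d) ℚ :=
  sqDistPoly d e.1.1 e.1.2

theorem equivalent_iff_aeval_sqEdgePoly {G : SimpleGraph V} {p q : Realization V d} :
    Equivalent G p q ↔ ∀ e, MvPolynomial.aeval (coords q) (sqEdgePoly d G e) =
      MvPolynomial.aeval (coords p) (sqEdgePoly d G e) := by
  simp only [sqEdgePoly, aeval_sqDistPoly, Subtype.forall, Prod.forall, Equivalent]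
  refine forall₃_congr fun x y _ => ?_
  rw [sq_eq_sq₀ (norm_nonneg _) (norm_nonneg _), eq_comm]

/-- In a rigid generic framework every squared distance is algebraic over the squared edge
lengths. -/
theorem IsRigidFramework.isAlgebraic_sqDist [Finite V] {G : SimpleGraph V} {p : Realization V d}
    (hG : IsRigidFramework G p) (hp : IsGeneric p) (u v : V) :
    IsAlgebraic (Algebra.adjoin ℚ
      (Set.range fun e => MvPolynomial.aeval (coords p) (sqEdgePoly d G e)))
      (MvPolynomial.aeval (coords p) (sqDistPoly d u v)) := by
  by_contra halg
  obtain ⟨ε, hε, h⟩ := hG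
  have hU : {y | ∀ x, ‖p x - ofCoords y x‖ < ε} ∈ nhds (coords p) := by
    refine Filter.eventually_all.2 fun x => ?_
    have hc : Continuous fun y : V × Fin d → ℝ => ‖p x - ofCoords y x‖ :=
      (continuous_const.sub ((continuous_apply x).comp continuous_ofCoords)).norm
    exact hc.continuousAt.eventually_lt continuousAt_const (by simpa using hε)
  obtain ⟨y, hyU, hyf, hyt⟩ := AlgebraicIndependent.exists_ne_of_not_isAlgebraic (p := coords p)
    hp _ _ halg hU
  have := h (ofCoords y) (equivalent_iff_aeval_sqEdgePoly.2 hyf) hyU u v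
  apply hyt
  have h1 := aeval_sqDistPoly (ofCoords y) u v
  rw [coords_ofCoords] at h1
  rw [h1, aeval_sqDistPoly, this]

/-! ### Semicontinuity of the least distance -/

theorem norm_sub_le_length_mul {G : SimpleGraph V} {q : Realization V d} {M : ℝ}
    (hM : ∀ x y, G.Adj x y → ‖q x - q y‖ ≤ M) {x y : V} (P : G.Walk x y) :
    ‖q x - q y‖ ≤ P.length * M := by
  induction P with
  | nil => simp
  | @cons a b c hab P ih =>
    have := norm_sub_le_norm_sub_add_norm_sub (q a) (q b) (q c)
    have := hM a b hab
    rw [SimpleGraph.Walk.length_cons]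
    push_cast
    linarith

theorem continuous_norm_sub (x y : V) : Continuous fun q : Realization V d => ‖q x - q y‖ :=
  ((continuous_apply x).sub (continuous_apply y)).norm

theorem isClosed_setOf_equivalent (G : SimpleGraph V) :
    IsClosed {z : Realization V d × Realization V d | Equivalent G z.1 z.2} := by
  simp only [Equivalent, Set.ofPred_forall]
  exact isClosed_iInter fun x => isClosed_iInter fun y => isClosed_iInter fun _ =>
    isClosed_eq ((continuous_norm_sub x y).comp continuous_fst)
      ((continuous_norm_sub x y).comp continuous_snd)

theorem eventually_lt_norm_of_equivalent {G : SimpleGraph V} {q₀ q : Realization V d}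
    {u v : V} {a : ℝ} (h : Equivalent G q₀ q → a < ‖q u - q v‖) :
    ∀ᶠ z : Realization V d × Realization V d in nhds (q₀, q),
      Equivalent G z.1 z.2 → a < ‖z.2 u - z.2 v‖ := by
  by_cases hq : Equivalent G q₀ q
  · have hc : Continuous fun z : Realization V d × Realization V d => ‖z.2 u - z.2 v‖ :=
      (continuous_norm_sub u v).comp continuous_snd
    exact ((hc.tendsto (q₀, q)).eventually_const_lt (h hq)).mono fun _ h _ => h
  · have hmem := (isClosed_setOf_equivalent (d := d) G).isOpen_compl.mem_nhds (x := (q₀, q)) hq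
    exact Filter.mem_of_superset hmem fun z hz hz' => absurd hz' hz

/-- The infimum of the distance between `u` and `v` over the equivalent realizations is lower
semicontinuous. -/
theorem eventually_forall_equivalent_lt_norm [Finite V] {G : SimpleGraph V} {q₀ : Realization V d}
    {u v : V} {a : ℝ} (h : ∀ q, Equivalent G q₀ q → a < ‖q u - q v‖) :
    ∀ᶠ q' in nhds q₀, ∀ q, Equivalent G q' q → a < ‖q u - q v‖ := by
  classical
  have := Fintype.ofFinite V
  obtain ⟨M, hM⟩ : ∃ M, ∀ x y : V, ‖q₀ x - q₀ y‖ < M := by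
    obtain ⟨M, hM⟩ := (Set.finite_range fun c : V × V => ‖q₀ c.1 - q₀ c.2‖).bddAbove
    exact ⟨M + 1, fun x y => (hM ⟨(x, y), rfl⟩).trans_lt (lt_add_one M)⟩
  have hMev : ∀ᶠ q' in nhds q₀, ∀ x y : V, ‖q' x - q' y‖ < M := by
    refine Filter.eventually_all.2 fun x => Filter.eventually_all.2 fun y => ?_
    exact (continuous_norm_sub x y).continuousAt.eventually_lt continuousAt_const (hM x y)
  obtain ⟨N, hN⟩ : ∃ N, ‖q₀‖ < N := exists_gt _
  have hN0 : 0 ≤ N := (norm_nonneg _).trans hN.le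
  have hNev : ∀ᶠ q' in nhds q₀, ‖q'‖ < N :=
    continuous_norm.continuousAt.eventually_lt continuousAt_const hN
  have hbound : ∀ z x, ∃ C : ℝ, ∀ q : Realization V d, (∀ x y, G.Adj x y → ‖q x - q y‖ ≤ M) →
      G.Reachable x z → ‖q x - q z‖ ≤ C := by
    intro z x
    by_cases hr : G.Reachable x z
    · exact ⟨hr.some.length * M, fun q hq _ => norm_sub_le_length_mul hq hr.some⟩
    · exact ⟨0, fun q _ h => absurd h hr⟩
  choose C hC using hbound
  -- `N` serves the components left in place; `|a|` bounds the step from `q v` to `q u` when `u` and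
  -- `v` lie in different components.
  let R : ℝ := |a| + N + ∑ x, (|C u x| + |C v x|)
  have hR : ∀ x, |a| + N + |C u x| + |C v x| ≤ R := fun x => by
    have := Finset.single_le_sum (f := fun x => |C u x| + |C v x|) (fun _ _ => by positivity)
      (Finset.mem_univ x)
    simp only [R]
    linarith
  have hcomp := (isCompact_closedBall (0 : Realization V d) R).eventually_forall_of_forall_eventually
    (x₀ := q₀) (P := fun q' q => Equivalent G q' q → a < ‖q u - q v‖) fun q _ =>
      eventually_lt_norm_of_equivalent (h q)
  filter_upwards [hcomp, hMev, hNev] with q' hq' hM' hN' q hqq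
  by_contra! hle
  -- Equivalent realizations can drift to infinity. Translating the components of `u` and `v`
  -- together, and resetting the others to `q'`, brings a counterexample into a fixed compact ball.
  let r : Realization V d := fun x =>
    if G.Reachable x u ∨ G.Reachable x v then q x - q u else q' x
  have hr : r u - r v = q u - q v := by simp [r]
  have hequiv : Equivalent G q' r := by
    intro x y hxy
    have hxu : G.Reachable x u ↔ G.Reachable y u :=
      ⟨fun h => hxy.reachable.symm.trans h, fun h => hxy.reachable.trans h⟩
    have hxv : G.Reachable x v ↔ G.Reachable y v :=
      ⟨fun h => hxy.reachable.symm.trans h, fun h => hxy.reachable.trans h⟩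
    by_cases hy : G.Reachable y u ∨ G.Reachable y v
    · simp [r, hxu, hxv, hy, hqq x y hxy]
    · simp [r, hxu, hxv, hy]
  have hqM : ∀ x y, G.Adj x y → ‖q x - q y‖ ≤ M := fun x y hxy =>
    (hqq x y hxy).symm.le.trans (hM' x y).le
  refine absurd (hq' r ?_ hequiv) (by rw [hr]; exact not_lt.2 hle)
  have hR0 : 0 ≤ R := by positivity
  rw [mem_closedBall_zero_iff, pi_norm_le_iff_of_nonneg hR0]
  intro x
  have h1 := hR x
  have h2 := le_abs_self (C u x)
  have h3 := le_abs_self (C v x)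
  have h4 := le_abs_self a
  have h5 := abs_nonneg (C u x)
  have h6 := abs_nonneg (C v x)
  have h7 := abs_nonneg a
  simp only [r]
  split_ifs with hx
  · rcases hx with hx | hx
    · linarith [hC u x q hqM hx]
    · have := hC v x q hqM hx
      have := norm_sub_le_norm_sub_add_norm_sub (q x) (q v) (q u)
      rw [norm_sub_rev (q v)] at this
      linarith
  · linarith [norm_le_pi_norm q' x]

end GraphRigidity

/-! ### Isolating the least distance -/

open Polynomial in
theorem Polynomial.continuous_eval_map_aeval {X E : Type*} [TopologicalSpace X]
    (P : (MvPolynomial E ℚ)[X]) {y : X → E → ℝ} (hy : Continuous y) :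
    Continuous fun z : X × ℝ => (P.map (MvPolynomial.aeval (y z.1)).toRingHom).eval z.2 := by
  simp_rw [Polynomial.eval_map, Polynomial.eval₂_eq_sum_range]
  refine continuous_finsetSum _ fun i _ => ?_
  exact ((MvPolynomial.continuous_aeval (A := ℝ) (P.coeff i)).comp
    (hy.comp continuous_fst)).mul (continuous_snd.pow i)

open Polynomial in
/-- A real polynomial has at most one root in an interval on which its derivative has no zero. -/
theorem Polynomial.eq_of_eval_eq_zero_of_derivative_ne_zero {Q : ℝ[X]} {c η s t : ℝ}
    (hQ : ∀ x, |x - c| < η → Q.derivative.eval x ≠ 0) (hs : |s - c| < η) (ht : |t - c| < η)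
    (hs0 : Q.eval s = 0) (ht0 : Q.eval t = 0) : s = t := by
  wlog hst : s ≤ t generalizing s t
  · exact (this ht hs ht0 hs0 (le_of_not_ge hst)).symm
  by_contra hne
  obtain ⟨x, hx, hx0⟩ := exists_deriv_eq_zero (f := fun x => Q.eval x) (lt_of_le_of_ne hst hne)
    Q.continuousOn (hs0.trans ht0.symm)
  rw [Polynomial.deriv] at hx0
  refine hQ x ?_ hx0
  rw [abs_lt] at *
  constructor <;> linarith [hx.1, hx.2]

namespace GraphRigidity

variable {V : Type*} {d : ℕ}

open Polynomial in
/-- In a rigid graph there is a realization near which every framework determines the distance of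
`u` and `v` among the equivalent frameworks in which this distance is not too large. -/
theorem IsRigid.exists_eventually_norm_eq [Finite V] {G : SimpleGraph V} (hG : IsRigid d G)
    (u v : V) : ∃ q₀ : Realization V d, ∃ δ > 0, ∀ᶠ q' in nhds q₀, ∀ q, Equivalent G q' q →
      ‖q u - q v‖ < ‖q₀ u - q₀ v‖ + δ → ‖q' u - q' v‖ = ‖q u - q v‖ := by
  obtain ⟨p, -, hp⟩ := exists_isGeneric_of_mem_nhds
    (Filter.univ_mem (f := nhds (0 : Realization V d)))
  obtain ⟨P, hP, hsep⟩ := AlgebraicIndependent.exists_separable_relation (p := coords p) hp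
    (sqEdgePoly d G) (sqDistPoly d u v) ((hG p hp).isAlgebraic_sqDist hp u v)
  let f : Realization V d → {e : V × V // G.Adj e.1 e.2} → ℝ :=
    fun q e => MvPolynomial.aeval (coords q) (sqEdgePoly d G e)
  have hf : Continuous f := continuous_pi fun e =>
    (MvPolynomial.continuous_aeval _).comp continuous_coords
  have hfeq : ∀ {q q'}, Equivalent G q q' → f q' = f q := fun h =>
    funext (equivalent_iff_aeval_sqEdgePoly.1 h)
  let Φ : Realization V d → ℝ[X] := fun q => P.map (MvPolynomial.aeval (f q)).toRingHom
  have hroot : ∀ q, (Φ q).eval (‖q u - q v‖ ^ 2) = 0 := fun q => by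
    rw [← aeval_sqDistPoly]
    exact hP (coords q)
  have hΦeq : ∀ {q q'}, Equivalent G q q' → Φ q' = Φ q := fun h => by
    simp only [Φ, hfeq h]
  have hΦp : (Φ p).Separable := hsep
  obtain ⟨q₀, hq₀, hmin⟩ : ∃ q₀, Equivalent G p q₀ ∧
      ∀ q, Equivalent G p q → ‖q₀ u - q₀ v‖ ≤ ‖q u - q v‖ := by
    let T : Set ℝ := {s | ∃ q, Equivalent G p q ∧ ‖q u - q v‖ = s}
    have hT : T.Finite := by
      have hfin : ((fun s : ℝ => s ^ 2) '' T).Finite := by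
        refine ((Φ p).rootSet_finite ℝ).subset ?_
        rintro _ ⟨_, ⟨q, hq, rfl⟩, rfl⟩
        rw [Polynomial.mem_rootSet]
        exact ⟨hΦp.ne_zero, by simpa [hΦeq hq] using hroot q⟩
      refine hfin.of_finite_image ?_
      rintro _ ⟨q, -, rfl⟩ _ ⟨q', -, rfl⟩ h
      exact (sq_eq_sq₀ (norm_nonneg _) (norm_nonneg _)).1 h
    obtain ⟨_, ⟨q₀, hq₀, rfl⟩, hmin⟩ := Set.exists_min_image T id hT
      ⟨_, p, fun _ _ _ => rfl, rfl⟩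
    exact ⟨q₀, hq₀, fun q hq => hmin _ ⟨q, hq, rfl⟩⟩
  -- Equivalence gives `Φ q₀ = Φ p`, which is separable, so the least squared distance is a simple
  -- root.
  have hder : (Φ q₀).derivative.eval (‖q₀ u - q₀ v‖ ^ 2) ≠ 0 := by
    have h0 := hroot q₀
    rw [hΦeq hq₀] at h0 ⊢
    simpa using hΦp.aeval_derivative_ne_zero (x := ‖q₀ u - q₀ v‖ ^ 2) (by simpa using h0)
  have hcont : Continuous fun z : Realization V d × ℝ => (Φ z.1).derivative.eval z.2 := by
    simp only [Φ, Polynomial.derivative_map]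
    exact Polynomial.continuous_eval_map_aeval _ hf
  have hev := (hcont.tendsto (q₀, ‖q₀ u - q₀ v‖ ^ 2)).eventually_ne hder
  rw [nhds_prod_eq] at hev
  obtain ⟨A, hA, B, hB, hAB⟩ := Filter.eventually_prod_iff.1 hev
  obtain ⟨η, hη, hηB⟩ := Metric.eventually_nhds_iff.1 hB
  obtain ⟨δ, hδ, hδη⟩ := Metric.continuous_iff.1 (continuous_pow (M := ℝ) 2)
    ‖q₀ u - q₀ v‖ η hη
  have hlow := eventually_forall_equivalent_lt_norm (G := G) (q₀ := q₀) (u := u) (v := v)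
    (a := ‖q₀ u - q₀ v‖ - δ) fun q hq => by linarith [hmin q (hq₀.trans hq)]
  have hup := ((continuous_norm_sub u v).tendsto q₀).eventually_lt_const
    (lt_add_of_pos_right _ hδ)
  refine ⟨q₀, δ, hδ, ?_⟩
  filter_upwards [hA, hlow, hup] with q' hA' hlow' hup' q hq hlt
  have hroot' := hroot q
  rw [hΦeq hq] at hroot'
  have hnear : ∀ s, ‖q₀ u - q₀ v‖ - δ < s → s < ‖q₀ u - q₀ v‖ + δ →
      |s ^ 2 - ‖q₀ u - q₀ v‖ ^ 2| < η := fun s h1 h2 => by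
    have := hδη s (by rw [Real.dist_eq, abs_lt]; constructor <;> linarith)
    rwa [Real.dist_eq] at this
  have := Polynomial.eq_of_eval_eq_zero_of_derivative_ne_zero (Q := Φ q')
    (fun x hx => hAB hA' (hηB (by rwa [Real.dist_eq])))
    (hnear _ (hlow' q' fun _ _ _ => rfl) hup') (hnear _ (hlow' q hq) hlt) (hroot q') hroot'
  exact (sq_eq_sq₀ (norm_nonneg _) (norm_nonneg _)).1 this

/-! ### Path lengths and the final construction -/

/-- The total length of a walk in a realization. -/
noncomputable def walkLength {G : SimpleGraph V} {u v : V} (P : G.Walk u v)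
    (q : Realization V d) : ℝ :=
  (P.darts.map fun a => ‖q a.fst - q a.snd‖).sum

theorem continuous_walkLength {G : SimpleGraph V} {u v : V} (P : G.Walk u v) :
    Continuous (walkLength (d := d) P) :=
  continuous_list_sum _ fun a _ => continuous_norm_sub a.fst a.snd

theorem Equivalent.walkLength_eq {G : SimpleGraph V} {u v : V} {p q : Realization V d}
    (h : Equivalent G p q) (P : G.Walk u v) : walkLength P p = walkLength P q := by
  unfold walkLength
  congr 1
  exact List.map_congr_left fun a _ => h _ _ a.adj

theorem norm_sub_le_walkLength {G : SimpleGraph V} {u v : V} (P : G.Walk u v)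
    (q : Realization V d) : ‖q u - q v‖ ≤ walkLength P q := by
  induction P with
  | nil => simp [walkLength]
  | @cons a b c hab P ih =>
    have := norm_sub_le_norm_sub_add_norm_sub (q a) (q b) (q c)
    simp only [walkLength, SimpleGraph.Walk.darts_cons, List.map_cons, List.sum_cons] at ih ⊢
    linarith

/-- A path all of whose vertices but the last one are at the same point is a segment. -/
theorem walkLength_eq_norm_sub {G : SimpleGraph V} {u v : V} {P : G.Walk u v} (hP : P.IsPath)
    {q : Realization V d} {z : EuclideanSpace ℝ (Fin d)}
    (hq : ∀ w ∈ P.support, w ≠ v → q w = z) : walkLength P q = ‖q u - q v‖ := by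
  induction P with
  | nil => simp [walkLength]
  | @cons a b c hab P ih =>
    rw [SimpleGraph.Walk.cons_isPath_iff] at hP
    have hac : a ≠ c := fun h => hP.2 (h ▸ P.end_mem_support)
    have ih := ih hP.1 fun w hw => hq w (by simp [hw])
    have ha : q a = z := hq a (by simp) hac
    simp only [walkLength, SimpleGraph.Walk.darts_cons, List.map_cons, List.sum_cons] at ih ⊢
    rw [ih]
    by_cases hbc : b = c
    · simp [hbc]
    · simp [ha, hq b (by simp) hbc]

end GraphRigidity

theorem mainTheorem8 {V : Type*} [Finite V] (d : ℕ) (G : SimpleGraph V) (u v : V)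
    (V₀ : Set V) (hV₀ : GraphRigidity.IsPairRigid d G u v V₀)
    (hP : ∃ P : G.Walk u v, GraphRigidity.IsInternallyDisjointPath P V₀) :
    GraphRigidity.WeaklyGloballyLinked d G u v := by
  classical
  open GraphRigidity in
  obtain ⟨hu, hv, hrigid⟩ := hV₀
  obtain ⟨P, hPath, hdisj⟩ := hP
  obtain ⟨q₀, δ, hδ, hq₀⟩ := hrigid.exists_eventually_norm_eq ⟨u, hu⟩ ⟨v, hv⟩
  -- All internal vertices of the path collapse onto `u`, leaving no slack in the triangle
  -- inequality.
  let p₀ : Realization V d := fun x => if h : x ∈ V₀ then q₀ ⟨x, h⟩ else q₀ ⟨u, hu⟩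
  let res : Realization V d → Realization V₀ d := fun q x => q x
  have hres : Continuous res := continuous_pi fun x => continuous_apply x.1
  have hres₀ : res p₀ = q₀ := by
    funext x
    simp [res, p₀]
  have hlen : walkLength P p₀ = ‖q₀ ⟨u, hu⟩ - q₀ ⟨v, hv⟩‖ := by
    rw [walkLength_eq_norm_sub hPath (z := q₀ ⟨u, hu⟩)]
    · simp [p₀, hu, hv]
    · intro w hw hwv
      by_cases hwu : w = u
      · simp [p₀, hwu, hu]
      · simp [p₀, hdisj w hw hwu hwv]
  have hev₁ := (hres.tendsto' p₀ q₀ hres₀).eventually hq₀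
  have hev₂ := ((continuous_walkLength (d := d) P).tendsto p₀).eventually_lt_const
    (u := ‖q₀ ⟨u, hu⟩ - q₀ ⟨v, hv⟩‖ + δ) (by linarith)
  obtain ⟨p, ⟨hp₁, hp₂⟩, hp⟩ := exists_isGeneric_of_mem_nhds (hev₁.and hev₂)
  refine ⟨p, hp, fun q hq => hp₁ (res q) (fun x y hxy => hq x y hxy) ?_⟩
  calc ‖q u - q v‖ ≤ walkLength P q := norm_sub_le_walkLength P q
    _ = walkLength P p := (hq.walkLength_eq P).symm
    _ < _ := hp₂
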